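/- **Local description of families.** Let $\Bbbk$ be an algebraically closed field and $V$ a finite-dimensional $\Bbbk$-vector space with coordinates $\alpha_1,\dots,\alpha_n$ (so $V=\mathbb{A}^n_{\Bbbk}$). For a commutative ring $A$ put $S_A=A[\alpha_1,\dots,\alpha_n]$ and let $P_A=\operatorname{Hom}_A(S_A,A)=A_{dp}[[x_1,\dots,x_n]]$ be the divided power series ring, where $F\in P_A$ has coefficient $F(\alpha^a)$ at $x^a$. It is an $S_A$-module by contraction: $(s\lrcorner F)(t)=F(st)$. For $F\in P_A$ put $\operatorname{Ann}(F)=\{s\in S_A : s\lrcorner F=0\}$ and $\operatorname{Apolar}(F)=S_A/\operatorname{Ann}(F)$; thus $\operatorname{Spec}\operatorname{Apolar}(F)$ is a closed subscheme of $V\times\operatorname{Spec}A$. The apolar family $\operatorname{Spec}\operatorname{Apolar}(F)\to\operatorname{Spec}A$ is called *flatly embedded* if the $A$-module $P_A/(S_A\lrcorner F)$ is flat. Let $T$ be a locally Noetherian $\Bbbk$-scheme, and let $X\subset V\times T$ be a closed subscheme such that $X\to T$ is finite and flat and every fibre $X_t$, $t\in T$, is a Gorenstein scheme (every local ring of $X_t$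 is an artinian local ring with one-dimensional socle over its residue field). Let $t_0\in T$ be a closed point. Then there are an affine open neighbourhood $U=\operatorname{Spec}A$ of $t_0$ and $F\in P_A$ such that $$X\times_T U=\operatorname{Spec}\operatorname{Apolar}(F)\quad\text{as closed subschemes of } V\times U,$$ $\operatorname{Apolar}(F)$ is a finite $A$-module, and $\operatorname{Spec}\operatorname{Apolar}(F)\to\operatorname{Spec}A$ is flatly embedded. Moreover: 1. If all fibres $X_t\subset V\times\operatorname{Spec}\kappa(t)$, $t\in T$, are supported at the origin, then one may take $F$ to be a polynomial, $F\in A_{dp}[x_1,\dots,x_n]$. 2. If all fibres $X_t\subset V\times\operatorname{Spec}\kappa(t)$, $t\in T$, are invariant under the dilation action of $\Bbbk^*$ and $T$ is reduced, then one may take $F$ to be a homogeneous polynomial, $F\in A_{dp}[x_1,\dots,x_n]$. -/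

import Mathlib

open CategoryTheory CategoryTheory.Limits AlgebraicGeometry

universe u

namespace ApolarFamily

noncomputable section

section Algebra

variable (σ : Type u) (A : Type u) [CommRing A]

/-- The divided power series ring `P_A = Hom_A(S_A, A) = A_dp[[x_i | i ∈ σ]]` as an `A`-module, where
`S_A = A[α_i | i ∈ σ]`. The functional `F` is the series whose coefficient at the (divided power)
monomial `x^a` is `F (α^a)`. -/
abbrev DPSeries : Type u := MvPolynomial σ A →ₗ[A] A

variable {σ A}

/-- The coefficient of `F` at the monomial `x^a`. -/
def coeff (a : σ →₀ ℕ) (F : DPSeries σ A) : A := F (MvPolynomial.monomial a 1)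

/-- A divided power series is the same as an arbitrary family of coefficients. -/
theorem coeff_bijective :
    Function.Bijective (fun (F : DPSeries σ A) (a : σ →₀ ℕ) => coeff a F) := by
  constructor
  · intro F G h
    refine (MvPolynomial.basisMonomials σ A).ext fun a => ?_
    simpa [coeff] using congrFun h a
  · intro c
    refine ⟨(MvPolynomial.basisMonomials σ A).constr A c, funext fun a => ?_⟩
    have h := (MvPolynomial.basisMonomials σ A).constr_basis A c a
    simpa [coeff] using h

/-- The contraction action `s ↦ s ⌟ F` of `S_A` on a fixed series `F`, namely precomposition:
`(s ⌟ F) (t) = F (s * t)`. -/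
def contract (F : DPSeries σ A) : MvPolynomial σ A →ₗ[A] DPSeries σ A :=
  (LinearMap.mul A (MvPolynomial σ A)).compr₂ F

@[simp]
theorem contract_apply (F : DPSeries σ A) (s t : MvPolynomial σ A) :
    contract F s t = F (s * t) := rfl

/-- The contraction formula: `α^a ⌟ x^(a + b) = x^b`, and `α^a` kills the monomials that are not
divisible by `x^a`. -/
theorem coeff_contract_monomial (F : DPSeries σ A) (a b : σ →₀ ℕ) :
    coeff b (contract F (MvPolynomial.monomial a 1)) = coeff (a + b) F := by
  simp [coeff, MvPolynomial.monomial_mul]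

/-- The apolar ideal `Ann(F) = {s ∈ S_A | s ⌟ F = 0}`. -/
def ann (F : DPSeries σ A) : Ideal (MvPolynomial σ A) where
  carrier := {s | contract F s = 0}
  add_mem' {s t} hs ht := by
    simp only [Set.mem_ofPred_eq] at hs ht ⊢
    rw [map_add, hs, ht, add_zero]
  zero_mem' := by simp
  smul_mem' c s hs := by
    simp only [Set.mem_ofPred_eq] at hs ⊢
    refine LinearMap.ext fun t => ?_
    have h := LinearMap.congr_fun hs (c * t)
    simpa [mul_comm, mul_left_comm, mul_assoc] using h

/-- The apolar algebra `Apolar(F) = S_A / Ann(F)`. -/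
abbrev Apolar (F : DPSeries σ A) : Type u := MvPolynomial σ A ⧸ ann F

/-- The apolar family of `F` is flatly embedded if the `A`-module `P_A / (S_A ⌟ F)` is flat. -/
def FlatlyEmbedded (F : DPSeries σ A) : Prop :=
  Module.Flat A (DPSeries σ A ⧸ LinearMap.range (contract F))

/-- `F` is a (divided power) polynomial: it has finitely many nonzero coefficients. -/
def IsPolynomial (F : DPSeries σ A) : Prop :=
  {a : σ →₀ ℕ | coeff a F ≠ 0}.Finite

/-- `F` is homogeneous of degree `d`: only monomials `x^a` with `|a| = d` occur. -/
def IsHomogeneous (F : DPSeries σ A) (d : ℕ) : Prop :=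
  ∀ a : σ →₀ ℕ, a.degree ≠ d → coeff a F = 0

/-- With finitely many variables, homogeneous series are polynomials. -/
theorem IsHomogeneous.isPolynomial [Finite σ] {F : DPSeries σ A} {d : ℕ} (h : IsHomogeneous F d) :
    IsPolynomial F := by
  refine (Finsupp.finite_of_degree_le d).subset fun a ha => ?_
  by_contra hd
  exact ha (h a fun h' => hd h'.le)

/-- A zero-dimensional Gorenstein local ring: an artinian local ring whose socle (the annihilator of
the maximal ideal) is one-dimensional over the residue field, that is, a simple module. -/
structure IsGorensteinArtinLocal (R : Type u) [CommRing R] [IsLocalRing R] : Prop where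
  isArtinianRing : IsArtinianRing R
  isSimple_socle : IsSimpleModule R (Module.annihilator R (IsLocalRing.maximalIdeal R))

end Algebra

section Geometry

variable {σ : Type u}

/-- The apolar family of `F`, embedded in `𝔸^σ` over `Spec A`: the closed subscheme
`Spec (A[α] / Ann F)` of `Spec A[α] = 𝔸(σ; Spec A)`. -/
def apolarι {A : CommRingCat.{u}} (F : DPSeries σ A) :
    Spec (.of (Apolar F)) ⟶ 𝔸(σ; Spec A) :=
  Spec.map (CommRingCat.ofHom (Ideal.Quotient.mk (ann F))) ≫ (AffineSpace.SpecIso σ A).inv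

variable {X T : Scheme.{u}} (i : X ⟶ 𝔸(σ; T))

/-- The base change `X ×_T T'` of an embedded family `X ⊆ 𝔸^σ × T` along `g : T' ⟶ T`. -/
def baseChange {T' : Scheme.{u}} (g : T' ⟶ T) : Scheme.{u} :=
  pullback i (AffineSpace.map σ g)

/-- The embedding `X ×_T T' ⊆ 𝔸^σ × T'` of the base change. -/
def baseChangeι {T' : Scheme.{u}} (g : T' ⟶ T) : baseChange i g ⟶ 𝔸(σ; T') :=
  pullback.snd i (AffineSpace.map σ g)

/-- The scheme-theoretic fibre `X_t` over `t : T`. -/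
abbrev fibre (t : T) : Scheme.{u} := baseChange i (T.fromSpecResidueField t)

/-- The embedding `X_t ⊆ 𝔸^σ_{κ(t)}` of the fibre. -/
abbrev fibreι (t : T) : fibre i t ⟶ 𝔸(σ; Spec (T.residueField t)) :=
  baseChangeι i (T.fromSpecResidueField t)

/-- The origin of affine space, as the zero section `S ⟶ 𝔸(σ; S)`. -/
def origin (σ : Type u) (S : Scheme.{u}) : S ⟶ 𝔸(σ; S) :=
  AffineSpace.homOfVector (𝟙 S) (fun _ => 0)

/-- The dilation `v ↦ c • v` of `𝔸(σ; S)`, where `S` is a scheme over `k` via `s` and `c ∈ k`. -/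
def dilation (σ : Type u) {k : Type u} [Field k] {S : Scheme.{u}} (s : S ⟶ Spec (.of k)) (c : k) :
    𝔸(σ; S) ⟶ 𝔸(σ; S) :=
  AffineSpace.homOfVector (𝔸(σ; S) ↘ S) fun j =>
    ((𝔸(σ; S) ↘ S) ≫ s).appTop ((Scheme.ΓSpecIso (.of k)).inv c) * AffineSpace.coord S j

/-- All local rings of the fibre over `t` are zero-dimensional Gorenstein rings. -/
def GorensteinFibre (t : T) : Prop :=
  ∀ z : fibre i t, IsGorensteinArtinLocal ((fibre i t).presheaf.stalk z)

/-- The fibre over `t` is supported at the origin of `𝔸^σ_{κ(t)}`. -/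
def FibreSupportedAtOrigin (t : T) : Prop :=
  Set.range (fibreι i t) ⊆ Set.range (origin σ (Spec (T.residueField t)))

/-- The fibre over `t` is invariant under the dilation action of `kˣ` on `𝔸^σ_{κ(t)}`, as a closed
subscheme: each dilation maps it into itself. -/
def FibreDilationInvariant {k : Type u} [Field k] (s : T ⟶ Spec (.of k)) (t : T) : Prop :=
  ∀ c : kˣ, ∃ φ : fibre i t ⟶ fibre i t,
    φ ≫ fibreι i t = fibreι i t ≫ dilation σ (T.fromSpecResidueField t ≫ s) (c : k)

/-- Over the affine open `U = Spec A` of `T`, the family `X ⊆ 𝔸^σ × T` is the apolar family of `F`,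
as a closed subscheme of `𝔸^σ × Spec A`. -/
def EqApolarOver {U : T.Opens} (hU : IsAffineOpen U) (F : DPSeries σ Γ(T, U)) : Prop :=
  ∃ e : baseChange i hU.fromSpec ≅ Spec (.of (Apolar F)), e.hom ≫ apolarι F = baseChangeι i hU.fromSpec

end Geometry

end

end ApolarFamily

/-! Over an affine open `Spec A`, the family is cut out by an ideal I of A[α] with A[α]/I finite and
projective over A. A series F vanishing on I is a functional on this quotient, and Ann(F) = I as
soon as the pairing (s, t) ↦ F(st) is perfect there, which a unit Gram determinant on a spanning
family ensures (`IsDualGenerator`). In that case S_A ⌟ F consists of all functionals vanishing on I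
and is a direct summand of P_A. Since P_A is a product of copies of the Noetherian ring A, it is
flat, and so is the cokernel.

On the fibre at t₀, the Gorenstein condition makes the pairing nondegenerate once the functional is
nonzero on each local socle; such a functional exists because the residue field is infinite
(`exists_ann_eq`). It lifts to A[α]/I by projectivity (`exists_lift_vanishes`). By Nakayama a lifted
basis spans after inverting one element, and inverting the Gram determinant as well gives the
neighbourhood (`exists_isDualGenerator_map`).

If the fibres are supported at the origin, the coordinates are nilpotent modulo I, so every
functional vanishing on I is a polynomial. If they are dilation invariant, their ideals are
homogeneous, and reducedness passes this on to I. The generator at t₀ can then be taken homogeneous,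
and the lift replaced by its homogeneous part. -/

namespace ApolarFamily

/-! ### Flatness of products over a Noetherian ring -/

section Flatness

/-- Over a Noetherian ring arbitrary powers of the ring are flat. -/
theorem flat_pi_of_isNoetherianRing (A : Type*) [CommRing A] [IsNoetherianRing A] (J : Type*) :
    Module.Flat A (J → A) := by
  refine Module.Flat.of_forall_isTrivialRelation fun {l f x} hfx => ?_
  -- The relations on f form a finitely generated module; each coordinate of x is a relation, and
  -- its coefficients on the generators trivialize the given one.
  obtain ⟨S, hS⟩ := (isNoetherian_def.mp (inferInstance : IsNoetherian A (Fin l → A)))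
    (LinearMap.ker (Fintype.linearCombination A f))
  have hx (j : J) : (fun i => x i j) ∈ Submodule.span A (S : Set (Fin l → A)) := by
    rw [hS, LinearMap.mem_ker, Fintype.linearCombination_apply]
    simpa [mul_comm] using congrFun hfx j
  have hc (j : J) : ∃ c : S → A, ∑ g, c g • (g : Fin l → A) = fun i => x i j := by
    simpa [Submodule.mem_span_finset'] using hx j
  choose c hc using hc
  let e := Fintype.equivFin S
  refine ⟨Fintype.card S, fun i k => (e.symm k : Fin l → A) i, fun k j => c j (e.symm k),
    fun i => ?_, fun k => ?_⟩
  · funext j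
    have h := congrFun (hc j) i
    simp only [Finset.sum_apply, Pi.smul_apply, smul_eq_mul] at h ⊢
    rw [e.symm.sum_comp (fun g : S => (g : Fin l → A) i * c j g), ← h,
      Finset.sum_congr rfl fun g _ => mul_comm _ _]
  · have h : (e.symm k : Fin l → A) ∈ LinearMap.ker (Fintype.linearCombination A f) :=
      hS ▸ Submodule.subset_span (e.symm k).2
    rw [LinearMap.mem_ker, Fintype.linearCombination_apply] at h
    simpa [mul_comm] using h

end Flatness

/-! ### Base change of series and dual generators -/

section Series

variable {σ A A' : Type u} [CommRing A] [CommRing A']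

theorem flat_dpSeries [IsNoetherianRing A] : Module.Flat A (DPSeries σ A) :=
  have := flat_pi_of_isNoetherianRing A (σ →₀ ℕ)
  Module.Flat.of_linearEquiv ((MvPolynomial.basisMonomials σ A).constr A).symm

theorem mem_ann {F : DPSeries σ A} {s : MvPolynomial σ A} :
    s ∈ ann F ↔ ∀ t, F (s * t) = 0 :=
  ⟨fun h t => LinearMap.congr_fun (show contract F s = 0 from h) t, fun h => LinearMap.ext h⟩

/-- The base change of a divided power series along a ring homomorphism. -/
noncomputable def DPSeries.map (f : A →+* A') (F : DPSeries σ A) : DPSeries σ A' :=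
  (MvPolynomial.basisMonomials σ A').constr A' fun a => f (coeff a F)

theorem coeff_map (f : A →+* A') (F : DPSeries σ A) (a : σ →₀ ℕ) :
    coeff a (F.map f) = f (coeff a F) := by
  have h := (MvPolynomial.basisMonomials σ A').constr_basis A' (fun a => f (coeff a F)) a
  rwa [MvPolynomial.coe_basisMonomials] at h

theorem apply_monomial (F : DPSeries σ A) (a : σ →₀ ℕ) (c : A) :
    F (MvPolynomial.monomial a c) = c * coeff a F := by
  rw [coeff, ← smul_eq_mul, ← map_smul, MvPolynomial.smul_monomial, smul_eq_mul, mul_one]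

theorem map_apply_map (f : A →+* A') (F : DPSeries σ A) (s : MvPolynomial σ A) :
    F.map f (MvPolynomial.map f s) = f (F s) := by
  induction s using MvPolynomial.induction_on' with
  | monomial a c => rw [MvPolynomial.map_monomial, apply_monomial, apply_monomial, coeff_map, map_mul]
  | add p q hp hq => rw [map_add, map_add, map_add, map_add, hp, hq]

theorem map_vanishes (f : A →+* A') {F : DPSeries σ A} {I : Ideal (MvPolynomial σ A)}
    (hF : ∀ s ∈ I, F s = 0) : ∀ s ∈ I.map (MvPolynomial.map f), F.map f s = 0 := by
  intro _ hs
  -- `F.map f` is only linear over A', so a free factor t is added to make the claim stable under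
  -- multiplication by polynomials.
  suffices h : ∀ t, F.map f (_ * t) = 0 by simpa using h 1
  induction hs using Submodule.span_induction with
  | mem x hx =>
    obtain ⟨y, hy, rfl⟩ := hx
    intro t
    induction t using MvPolynomial.induction_on' with
    | monomial a c =>
      have h : MvPolynomial.map f y * MvPolynomial.monomial a c =
          c • MvPolynomial.map f (y * MvPolynomial.monomial a 1) := by
        rw [map_mul, MvPolynomial.map_monomial, map_one, ← mul_smul_comm,
          MvPolynomial.smul_monomial, smul_eq_mul, mul_one]
      rw [h, map_smul, map_apply_map, hF _ (I.mul_mem_right _ hy), map_zero, smul_zero]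
    | add p q hp hq => rw [mul_add, map_add, hp, hq, add_zero]
  | zero => simp
  | add x y _ _ hx hy => intro t; rw [add_mul, map_add, hx, hy, add_zero]
  | smul u x _ hx => intro t; rw [smul_eq_mul, mul_comm u, mul_assoc, hx]

/-- `F` is a dual generator of `A[α] / I`: it induces a perfect pairing on `A[α] / I`, of which the
images of the `b i` are a basis. -/
structure IsDualGenerator {ι : Type*} [Fintype ι] [DecidableEq ι] (F : DPSeries σ A)
    (I : Ideal (MvPolynomial σ A)) (b : ι → MvPolynomial σ A) : Prop where
  vanishes : ∀ s ∈ I, F s = 0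
  spans : ∀ s, ∃ c : ι → A, s - ∑ i, c i • b i ∈ I
  isUnit_det : IsUnit (Matrix.of fun i j => F (b i * b j)).det

variable {ι : Type*} [Fintype ι] {F : DPSeries σ A}
  {I : Ideal (MvPolynomial σ A)} {b : ι → MvPolynomial σ A}

theorem le_ann_of_vanishes (hF : ∀ s ∈ I, F s = 0) : I ≤ ann F :=
  fun _ hs => mem_ann.mpr fun t => hF _ (I.mul_mem_right t hs)

/-- A family that spans `A[α] / I` up to `r` spans every base change in which `r` is a unit. -/
theorem exists_sub_sum_mem_map (f : A →+* A') {r : A} (hr : IsUnit (f r))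
    (hb : ∀ s, ∃ c : ι → A, MvPolynomial.C r * s - ∑ i, c i • b i ∈ I) (s : MvPolynomial σ A') :
    ∃ c : ι → A', s - ∑ i, c i • MvPolynomial.map f (b i) ∈ I.map (MvPolynomial.map f) := by
  induction s using MvPolynomial.induction_on' with
  | monomial a d =>
    obtain ⟨c, hc⟩ := hb (MvPolynomial.monomial a 1)
    obtain ⟨u, hu⟩ := hr
    refine ⟨fun i => d * ↑u⁻¹ * f (c i), ?_⟩
    have h₁ := Ideal.mul_mem_left _ (MvPolynomial.C (d * ↑u⁻¹))
      (Ideal.mem_map_of_mem (MvPolynomial.map f) hc)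
    have h₂ : MvPolynomial.monomial a d = MvPolynomial.C (d * ↑u⁻¹) *
        MvPolynomial.map f (MvPolynomial.C r * MvPolynomial.monomial a 1) := by
      rw [map_mul (MvPolynomial.map f), MvPolynomial.map_C, MvPolynomial.map_monomial, ← hu,
        ← mul_assoc, ← MvPolynomial.C_mul, mul_assoc d, Units.inv_mul, mul_one,
        MvPolynomial.C_mul_monomial, map_one, mul_one]
    have h₃ : ∑ i, (d * ↑u⁻¹ * f (c i)) • MvPolynomial.map f (b i) =
        MvPolynomial.C (d * ↑u⁻¹) * MvPolynomial.map f (∑ i, c i • b i) := by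
      simp only [MvPolynomial.smul_eq_C_mul, map_sum, map_mul, MvPolynomial.map_C, mul_assoc,
        Finset.mul_sum]
    rwa [h₂, h₃, ← mul_sub, ← map_sub]
  | add p q hp hq =>
    obtain ⟨c, hc⟩ := hp
    obtain ⟨d, hd⟩ := hq
    refine ⟨c + d, ?_⟩
    convert Ideal.add_mem _ hc hd using 1
    simp only [Pi.add_apply, add_smul, Finset.sum_add_distrib]
    ring

theorem finite_quotient_of_spans (hb : ∀ s, ∃ c : ι → A, s - ∑ i, c i • b i ∈ I) :
    Module.Finite A (MvPolynomial σ A ⧸ I) := by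
  refine ⟨Submodule.fg_def.mpr ⟨_, Set.finite_range (fun i => Ideal.Quotient.mk I (b i)),
    eq_top_iff.mpr fun x _ => ?_⟩⟩
  obtain ⟨s, rfl⟩ := Ideal.Quotient.mk_surjective x
  obtain ⟨c, hc⟩ := hb s
  rw [← Ideal.Quotient.eq] at hc
  rw [hc, map_sum]
  refine Submodule.sum_mem _ fun i _ => ?_
  exact Submodule.smul_mem _ (c i) (Submodule.subset_span (Set.mem_range_self i))

theorem exists_spans_of_finite [Module.Finite A (MvPolynomial σ A ⧸ I)] :
    ∃ (n : ℕ) (b : Fin n → MvPolynomial σ A), ∀ s, ∃ c : Fin n → A, s - ∑ i, c i • b i ∈ I := by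
  obtain ⟨n, x, hx⟩ := Module.Finite.exists_fin (R := A) (M := MvPolynomial σ A ⧸ I)
  choose b hb using fun i => Ideal.Quotient.mk_surjective (x i)
  refine ⟨n, b, fun s => ?_⟩
  obtain ⟨c, hc⟩ := (Submodule.mem_span_range_iff_exists_fun A).mp
    (hx ▸ Submodule.mem_top : Ideal.Quotient.mk I s ∈ Submodule.span A (Set.range x))
  refine ⟨c, Ideal.Quotient.eq.mp ?_⟩
  rw [← hc, map_sum]
  exact Finset.sum_congr rfl fun i _ => by rw [← hb]; rfl

theorem finite_quotient_map [Module.Finite A (MvPolynomial σ A ⧸ I)] (f : A →+* A') :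
    Module.Finite A' (MvPolynomial σ A' ⧸ I.map (MvPolynomial.map f)) := by
  obtain ⟨n, b, hb⟩ := exists_spans_of_finite (I := I)
  exact finite_quotient_of_spans
    (exists_sub_sum_mem_map f (r := 1) (by simp) fun s => by simpa using hb s)

theorem vanishes_of_ann_eq (hF : ann F = I) : ∀ s ∈ I, F s = 0 := fun s hs => by
  simpa using mem_ann.mp (hF.ge hs) 1

namespace IsDualGenerator

variable [DecidableEq ι]

theorem eq_of_forall_eq (h : IsDualGenerator F I b) {G H : DPSeries σ A}
    (hG : ∀ s ∈ I, G s = 0) (hH : ∀ s ∈ I, H s = 0) (hb : ∀ j, G (b j) = H (b j)) : G = H := by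
  refine LinearMap.ext fun s => ?_
  obtain ⟨c, hc⟩ := h.spans s
  have h₁ := hG _ hc
  have h₂ := hH _ hc
  rw [map_sub, sub_eq_zero] at h₁ h₂
  rw [h₁, h₂]
  simp [hb]

theorem contract_vanishes (h : IsDualGenerator F I b) (s : MvPolynomial σ A) :
    ∀ t ∈ I, contract F s t = 0 :=
  fun _ ht => h.vanishes _ (I.mul_mem_left s ht)

/-- Modulo I an annihilating element is a combination of the b i; pairing it with every b j gives c
M = 0, and the Gram matrix M is invertible. -/
theorem ann_eq (h : IsDualGenerator F I b) : ann F = I := by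
  refine le_antisymm (fun s hs => ?_) (le_ann_of_vanishes h.vanishes)
  obtain ⟨c, hc⟩ := h.spans s
  have hc' := le_ann_of_vanishes h.vanishes hc
  have hs' : ∑ i, c i • b i ∈ ann F := by simpa using (ann F).sub_mem hs hc'
  have hc0 : c = 0 := by
    refine Matrix.vecMul_injective_of_isUnit
      ((Matrix.isUnit_iff_isUnit_det _).mpr h.isUnit_det) ?_
    change Matrix.vecMul c _ = Matrix.vecMul 0 _
    rw [Matrix.zero_vecMul]
    funext j
    simpa [Matrix.vecMul, dotProduct, Finset.sum_mul] using mem_ann.mp hs' (b j)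
  simpa [hc0] using hc

theorem finite_apolar (h : IsDualGenerator F I b) : Module.Finite A (Apolar F) := by
  have := h.ann_eq
  subst this
  exact finite_quotient_of_spans h.spans

/-- The submodule `S_A ⌟ F` is a direct summand of `P_A`, so that its cokernel is flat. -/
theorem flatlyEmbedded [IsNoetherianRing A] (h : IsDualGenerator F I b) : FlatlyEmbedded F := by
  have := flat_dpSeries (σ := σ) (A := A)
  have hu := (Matrix.isUnit_iff_isUnit_det _).mpr h.isUnit_det
  set M : Matrix ι ι A := Matrix.of fun i j => F (b i * b j) with hM
  let ev : DPSeries σ A →ₗ[A] ι → A := LinearMap.pi fun j => LinearMap.applyₗ (b j)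
  -- Projection onto the functionals vanishing on I: G goes to the contraction of F by the
  -- combination of the b i whose pairing with each b j is G (b j).
  let π : DPSeries σ A →ₗ[A] DPSeries σ A :=
    contract F ∘ₗ Fintype.linearCombination A b ∘ₗ Matrix.vecMulLinear M⁻¹ ∘ₗ ev
  have hπ (G : DPSeries σ A) (hG : ∀ s ∈ I, G s = 0) : π G = G := by
    refine h.eq_of_forall_eq (h.contract_vanishes _) hG fun j => ?_
    have h₁ (c : ι → A) : contract F (Fintype.linearCombination A b c) (b j) =
        Matrix.vecMul c M j := by
      simp [Matrix.vecMul, dotProduct, hM, Fintype.linearCombination_apply]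
    change contract F (Fintype.linearCombination A b (Matrix.vecMul (ev G) M⁻¹)) (b j) = _
    rw [h₁, Matrix.vecMul_vecMul, Matrix.nonsing_inv_mul _ h.isUnit_det, Matrix.vecMul_one]
    rfl
  refine Module.Flat.of_retract
    ((LinearMap.range (contract F)).liftQ (LinearMap.id - π) ?_)
    (LinearMap.range (contract F)).mkQ ?_
  · rintro _ ⟨s, rfl⟩
    simp [hπ _ (h.contract_vanishes s)]
  · refine Submodule.linearMap_qext _ (LinearMap.ext fun G => ?_)
    have hG : (LinearMap.range (contract F)).mkQ (π G) = 0 :=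
      (Submodule.Quotient.mk_eq_zero _).mpr ⟨_, rfl⟩
    simpa using hG

/-- A dual generator after inverting an element that annihilates the obstructions. -/
theorem of_map {f : A →+* A'} {r : A} (hF : ∀ s ∈ I, F s = 0)
    (hb : ∀ s, ∃ c : ι → A, MvPolynomial.C r * s - ∑ i, c i • b i ∈ I) (hr : IsUnit (f r))
    (hd : IsUnit (f (Matrix.of fun i j => F (b i * b j)).det)) :
    IsDualGenerator (F.map f) (I.map (MvPolynomial.map f)) fun i => MvPolynomial.map f (b i) where
  vanishes := map_vanishes f hF
  spans := exists_sub_sum_mem_map f hr hb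
  isUnit_det := by
    convert hd using 1
    rw [RingHom.map_det]
    congr 1
    ext i j
    simp [← map_mul, map_apply_map]

end IsDualGenerator

end Series

/-! ### Spreading a dual generator out from a fibre -/

section Lifting

variable {σ A K : Type u} [CommRing A] [Field K] {ψ : A →+* K}

/-- If `A[α] / I` is finite and flat, functionals on a fibre lift to functionals on `A[α] / I`. -/
theorem exists_lift_vanishes [IsNoetherianRing A] {I : Ideal (MvPolynomial σ A)}
    [Module.Finite A (MvPolynomial σ A ⧸ I)] [Module.Flat A (MvPolynomial σ A ⧸ I)]
    (hψ : Function.Surjective ψ) {F₀ : DPSeries σ K}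
    (hF₀ : ∀ s ∈ I.map (MvPolynomial.map ψ), F₀ s = 0) :
    ∃ F : DPSeries σ A, (∀ s ∈ I, F s = 0) ∧ ∀ s, ψ (F s) = F₀ (MvPolynomial.map ψ s) := by
  -- K is viewed as an A-module through ψ, so that A → K is a surjection along which functionals on
  -- the projective module A[α]/I lift.
  let _ := ψ.toAlgebra
  have := Module.finitePresentation_of_finite A (MvPolynomial σ A ⧸ I)
  have := Module.Flat.projective_of_finitePresentation (R := A) (M := MvPolynomial σ A ⧸ I)
  let g : MvPolynomial σ A →ₗ[A] K :=
    { toFun := fun s => F₀ (MvPolynomial.map ψ s)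
      map_add' := fun s t => by rw [map_add, map_add]
      map_smul' := fun a s => by
        rw [MvPolynomial.smul_eq_C_mul, map_mul, MvPolynomial.map_C, ← MvPolynomial.smul_eq_C_mul,
          map_smul, RingHom.id_apply, smul_eq_mul]
        rfl }
  let g' : (MvPolynomial σ A ⧸ I) →ₗ[A] K :=
    (I.restrictScalars A).liftQ g fun s hs => hF₀ _ (Ideal.mem_map_of_mem _ hs)
  obtain ⟨φ, hφ⟩ := Module.projective_lifting_property (Algebra.linearMap A K) g' hψ
  refine ⟨φ ∘ₗ (Ideal.Quotient.mkₐ A I).toLinearMap, fun s hs => ?_, fun s => ?_⟩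
  · simp [Ideal.Quotient.eq_zero_iff_mem.mpr hs]
  · exact LinearMap.congr_fun hφ (Ideal.Quotient.mk I s)

/-- A basis of a fibre of `A[α] / I` lifts to a family that spans `A[α] / I` locally. -/
theorem exists_lift_basis {I : Ideal (MvPolynomial σ A)}
    [Module.Finite A (MvPolynomial σ A ⧸ I)] (hψ : Function.Surjective ψ) :
    ∃ (n : ℕ) (b : Fin n → MvPolynomial σ A) (r : A), ψ r ≠ 0 ∧
      (∀ s, ∃ c : Fin n → A, MvPolynomial.C r * s - ∑ i, c i • b i ∈ I) ∧
      (∀ c : Fin n → K, ∑ i, c i • MvPolynomial.map ψ (b i) ∈ I.map (MvPolynomial.map ψ) → c = 0) ∧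
      ∀ s, ∃ c : Fin n → K,
        s - ∑ i, c i • MvPolynomial.map ψ (b i) ∈ I.map (MvPolynomial.map ψ) := by
  have hmap : Function.Surjective (MvPolynomial.map (σ := σ) ψ) := MvPolynomial.map_surjective ψ hψ
  have := finite_quotient_map (I := I) ψ
  set J := I.map (MvPolynomial.map ψ) with hJ
  let e := Module.finBasis K (MvPolynomial σ K ⧸ J)
  choose b hb using fun i => (Ideal.Quotient.mk_surjective.comp hmap) (e i)
  have hsum (c : Fin (Module.finrank K (MvPolynomial σ K ⧸ J)) → K) :
      Ideal.Quotient.mk J (∑ i, c i • MvPolynomial.map ψ (b i)) = ∑ i, c i • e i := by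
    rw [map_sum]
    exact Finset.sum_congr rfl fun i _ => by rw [← hb]; rfl
  have hspan (s) : ∃ c : Fin _ → K, s - ∑ i, c i • MvPolynomial.map ψ (b i) ∈ J := by
    refine ⟨e.repr (Ideal.Quotient.mk J s), Ideal.Quotient.eq.mp ?_⟩
    rw [hsum, e.sum_repr]
  -- Input for Nakayama: expand in the fibre and lift the coefficients; the error lies in I plus the
  -- extension of ker ψ.
  have hsup : (⊤ : Submodule A (MvPolynomial σ A ⧸ I)) ≤
      Submodule.span A (Set.range fun i => Ideal.Quotient.mk I (b i)) ⊔ RingHom.ker ψ • ⊤ := by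
    intro x _
    obtain ⟨s, rfl⟩ := Ideal.Quotient.mk_surjective x
    obtain ⟨c, hc⟩ := hspan (MvPolynomial.map ψ s)
    choose d hd using fun i => hψ (c i)
    obtain ⟨t, ht, hts⟩ := (Ideal.mem_map_iff_of_surjective _ hmap).mp hc
    have hker : s - ∑ i, d i • b i - t ∈ RingHom.ker (MvPolynomial.map (σ := σ) ψ) := by
      rw [RingHom.mem_ker, map_sub, hts, map_sub, sub_eq_zero]
      simp [MvPolynomial.smul_eq_C_mul, hd]
    rw [MvPolynomial.ker_map] at hker
    have hker' : Ideal.Quotient.mk I (s - ∑ i, d i • b i - t) ∈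
        RingHom.ker ψ • (⊤ : Submodule A (MvPolynomial σ A ⧸ I)) := by
      have h₁ : s - ∑ i, d i • b i - t ∈ RingHom.ker ψ • (⊤ : Submodule A (MvPolynomial σ A)) := by
        rwa [Ideal.smul_top_eq_map]
      have h₂ := Submodule.mem_map_of_mem (f := (Ideal.Quotient.mkₐ A I).toLinearMap) h₁
      rw [Submodule.map_smul''] at h₂
      exact Submodule.smul_mono le_rfl le_top h₂
    have hd' : Ideal.Quotient.mk I s = Ideal.Quotient.mk I (∑ i, d i • b i) +
        Ideal.Quotient.mk I (s - ∑ i, d i • b i - t) := by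
      rw [map_sub, Ideal.Quotient.eq_zero_iff_mem.mpr ht, sub_zero, ← map_add]
      congr 1
      ring
    rw [hd', map_sum]
    exact Submodule.add_mem_sup (Submodule.sum_mem _ fun i _ => Submodule.smul_mem _ (d i)
      (Submodule.subset_span (Set.mem_range_self i))) hker'
  -- Nakayama without a local ring: r is 1 modulo ker ψ, hence ψ r = 1.
  obtain ⟨r, hr, hrN⟩ := Submodule.exists_sub_one_mem_and_smul_le_of_fg_of_le_sup
    Module.Finite.fg_top le_rfl hsup
  refine ⟨_, b, r, ?_, fun s => ?_, fun c hc => ?_, hspan⟩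
  · rw [RingHom.mem_ker, map_sub, map_one, sub_eq_zero] at hr
    simp [hr]
  · have h := hrN (Submodule.smul_mem_pointwise_smul (Ideal.Quotient.mk I s) r ⊤ trivial)
    obtain ⟨c, hc⟩ := (Submodule.mem_span_range_iff_exists_fun A).mp h
    refine ⟨c, Ideal.Quotient.eq.mp ?_⟩
    rw [map_sum, ← MvPolynomial.smul_eq_C_mul]
    exact hc.symm
  · rw [← Ideal.Quotient.eq_zero_iff_mem, hsum] at hc
    exact funext (Fintype.linearIndependent_iff.mp e.linearIndependent c hc)

/-- The Gram matrix of a nondegenerate functional on a basis of `K[α] / J` is invertible. -/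
theorem det_ne_zero_of_ann_le {ι : Type*} [Fintype ι] [DecidableEq ι]
    {J : Ideal (MvPolynomial σ K)} {b : ι → MvPolynomial σ K} {F₀ : DPSeries σ K}
    (hF₀ : ann F₀ = J)
    (hind : ∀ c : ι → K, ∑ i, c i • b i ∈ J → c = 0)
    (hspan : ∀ s, ∃ c : ι → K, s - ∑ i, c i • b i ∈ J) :
    (Matrix.of fun i j => F₀ (b i * b j)).det ≠ 0 := by
  intro h
  obtain ⟨c, hc, hc0⟩ := Matrix.exists_vecMul_eq_zero_iff.mpr h
  refine hc (hind c (hF₀ ▸ mem_ann.mpr fun t => ?_))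
  have hb (j : ι) : F₀ ((∑ i, c i • b i) * b j) = 0 := by
    simpa [Matrix.vecMul, dotProduct, Finset.sum_mul] using congrFun hc0 j
  -- It suffices to test against the b j: the rest of t lies in J = Ann(F₀) and pairs to zero.
  obtain ⟨d, hd⟩ := hspan t
  have h₁ := mem_ann.mp (hF₀.ge hd) (∑ i, c i • b i)
  rw [mul_comm, mul_sub, map_sub, sub_eq_zero] at h₁
  rw [h₁, Finset.mul_sum, map_sum]
  exact Finset.sum_eq_zero fun j _ => by rw [mul_smul_comm, map_smul, hb, smul_zero]

/-- A dual generator of a fibre extends to a neighbourhood, whatever lift `F` is chosen. -/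
theorem exists_isDualGenerator_map {I : Ideal (MvPolynomial σ A)}
    [Module.Finite A (MvPolynomial σ A ⧸ I)] (hψ : Function.Surjective ψ) {F : DPSeries σ A}
    (hF : ∀ s ∈ I, F s = 0) {F₀ : DPSeries σ K} (hF₀ : ann F₀ = I.map (MvPolynomial.map ψ))
    (hFF₀ : ∀ s, ψ (F s) = F₀ (MvPolynomial.map ψ s)) :
    ∃ r : A, ψ r ≠ 0 ∧ ∀ {A' : Type u} [CommRing A'] (f : A →+* A'), IsUnit (f r) →
      ∃ (n : ℕ) (b : Fin n → MvPolynomial σ A'),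
        IsDualGenerator (F.map f) (I.map (MvPolynomial.map f)) b := by
  obtain ⟨n, b, r, hr, hb, hind, hspan⟩ := exists_lift_basis (I := I) hψ
  refine ⟨r * (Matrix.of fun i j => F (b i * b j)).det, ?_, fun f hf => ?_⟩
  · rw [map_mul]
    refine mul_ne_zero hr ?_
    convert det_ne_zero_of_ann_le hF₀ hind hspan
    rw [RingHom.map_det]
    congr 1
    ext i j
    simp [← map_mul, hFF₀]
  · rw [map_mul, IsUnit.mul_iff] at hf
    exact ⟨n, _, IsDualGenerator.of_map hF hb hf.1 hf.2⟩

end Lifting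

/-! ### Homogeneous parts of series -/

section Homogeneous

variable {σ A : Type u} [CommRing A]

/-- The homogeneous part of degree `d` of a divided power series. -/
noncomputable def homogeneousPart (d : ℕ) (F : DPSeries σ A) : DPSeries σ A :=
  F ∘ₗ MvPolynomial.homogeneousComponent d

theorem homogeneousComponent_monomial (d : ℕ) (a : σ →₀ ℕ) (c : A) :
    MvPolynomial.homogeneousComponent d (MvPolynomial.monomial a c) =
      if a.degree = d then MvPolynomial.monomial a c else 0 := by
  classical
  ext b
  rw [MvPolynomial.coeff_homogeneousComponent]
  split_ifs with h₁ h₂ h₂ <;> simp only [MvPolynomial.coeff_monomial, MvPolynomial.coeff_zero]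
  · exact if_neg fun (h : a = b) => h₂ (h ▸ h₁)
  · exact (if_neg fun (h : a = b) => h₁ (h ▸ h₂)).symm

theorem isHomogeneous_homogeneousPart (d : ℕ) (F : DPSeries σ A) :
    IsHomogeneous (homogeneousPart d F) d := fun a ha => by
  rw [coeff, homogeneousPart, LinearMap.comp_apply, homogeneousComponent_monomial, if_neg ha,
    map_zero]

theorem IsHomogeneous.apply_homogeneousComponent {F : DPSeries σ A} {d : ℕ}
    (hF : IsHomogeneous F d) (s : MvPolynomial σ A) :
    F (MvPolynomial.homogeneousComponent d s) = F s := by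
  induction s using MvPolynomial.induction_on' with
  | monomial a c =>
    rw [homogeneousComponent_monomial]
    split_ifs with h
    · rfl
    · rw [map_zero, apply_monomial, hF a h, mul_zero]
  | add p q hp hq => rw [map_add, map_add, map_add, hp, hq]

theorem homogeneousPart_vanishes {d : ℕ} {F : DPSeries σ A} {I : Ideal (MvPolynomial σ A)}
    (hI : ∀ s ∈ I, ∀ d, MvPolynomial.homogeneousComponent d s ∈ I) (hF : ∀ s ∈ I, F s = 0) :
    ∀ s ∈ I, homogeneousPart d F s = 0 :=
  fun s hs => hF _ (hI s hs d)

theorem homogeneousComponent_map {A' : Type u} [CommRing A'] (f : A →+* A') (d : ℕ)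
    (s : MvPolynomial σ A) : MvPolynomial.homogeneousComponent d (MvPolynomial.map f s) =
      MvPolynomial.map f (MvPolynomial.homogeneousComponent d s) := by
  classical
  ext b
  simp only [MvPolynomial.coeff_homogeneousComponent, MvPolynomial.coeff_map]
  split_ifs <;> simp

theorem IsHomogeneous.map {A' : Type u} [CommRing A'] (f : A →+* A') {F : DPSeries σ A} {d : ℕ}
    (hF : IsHomogeneous F d) : IsHomogeneous (F.map f) d := fun a ha => by
  rw [coeff_map, hF a ha, map_zero]

end Homogeneous

/-! ### Socles and their localization -/

section Socle

/-- For every maximal ideal `m`, the elements killed by `m` form a module generated by any one of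
its nonzero elements. -/
def HasSimpleSocles (R : Type*) [CommRing R] : Prop :=
  ∀ m : Ideal R, m.IsMaximal → ∀ x y : R, x ≠ 0 → (∀ p ∈ m, p * x = 0) → (∀ p ∈ m, p * y = 0) →
    ∃ r, y = r * x

theorem IsGorensteinArtinLocal.exists_eq_mul {R : Type u} [CommRing R] [IsLocalRing R]
    (h : IsGorensteinArtinLocal R) {x y : R} (hx0 : x ≠ 0)
    (hx : ∀ p ∈ IsLocalRing.maximalIdeal R, p * x = 0)
    (hy : ∀ p ∈ IsLocalRing.maximalIdeal R, p * y = 0) : ∃ r, y = r * x := by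
  have := h.isSimple_socle
  have hmem {z : R} (hz : ∀ p ∈ IsLocalRing.maximalIdeal R, p * z = 0) :
      z ∈ Module.annihilator R (IsLocalRing.maximalIdeal R) :=
    Module.mem_annihilator.mpr fun p => Subtype.ext <| by
      simpa [mul_comm] using hz p p.2
  have hx0' : (⟨x, hmem hx⟩ : Module.annihilator R (IsLocalRing.maximalIdeal R)) ≠ 0 :=
    fun h => hx0 (congrArg Subtype.val h)
  obtain ⟨r, hr⟩ := IsSimpleModule.toSpanSingleton_surjective R hx0' ⟨y, hmem hy⟩
  exact ⟨r, (congrArg Subtype.val hr).symm⟩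

/-- Elements outside m are invertible modulo m, so they act invertibly on whatever m kills. Hence
localization loses no socle element, and denominators can be cleared. -/
theorem exists_eq_mul_of_isLocalization {R : Type*} [CommRing R] (m : Ideal R) [m.IsMaximal]
    {S : Type u} [CommRing S] [IsLocalRing S] [Algebra R S] [IsLocalization.AtPrime S m]
    (hS : IsGorensteinArtinLocal S) {x y : R} (hx0 : x ≠ 0) (hx : ∀ p ∈ m, p * x = 0)
    (hy : ∀ p ∈ m, p * y = 0) : ∃ r, y = r * x := by
  have hkill {u z : R} (hu : u ∉ m) (hz : ∀ p ∈ m, p * z = 0) (huz : u * z = 0) : z = 0 := by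
    obtain ⟨v, w, hw, hvw⟩ := Ideal.IsMaximal.exists_inv ‹m.IsMaximal› hu
    rw [← one_mul z, ← hvw, add_mul, mul_assoc, huz, hz w hw, mul_zero, add_zero]
  have hloc {z : R} (hz : ∀ p ∈ m, p * z = 0) :
      ∀ p ∈ IsLocalRing.maximalIdeal S, p * algebraMap R S z = 0 := by
    intro p hp
    rw [← IsLocalization.AtPrime.map_eq_maximalIdeal m S] at hp
    induction hp using Submodule.span_induction with
    | mem p hp =>
      obtain ⟨q, hq, rfl⟩ := hp
      rw [← map_mul, hz q hq, map_zero]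
    | zero => rw [zero_mul]
    | add p q _ _ hp hq => rw [add_mul, hp, hq, add_zero]
    | smul a p _ hp => rw [smul_eq_mul, mul_assoc, hp, mul_zero]
  have hx1 : algebraMap R S x ≠ 0 := fun h => by
    obtain ⟨u, hu⟩ := (IsLocalization.map_eq_zero_iff m.primeCompl S x).mp h
    exact hx0 (hkill u.2 hx hu)
  obtain ⟨r, hr⟩ := hS.exists_eq_mul hx1 (hloc hx) (hloc hy)
  obtain ⟨⟨a, s⟩, has⟩ := IsLocalization.surj m.primeCompl r
  have h₁ : algebraMap R S (s * y) = algebraMap R S (a * x) := by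
    rw [map_mul, map_mul, hr, ← has]
    ring
  obtain ⟨u, hu⟩ := (IsLocalization.eq_iff_exists m.primeCompl S).mp h₁
  have h₂ : s * y - a * x = 0 := by
    refine hkill u.2 (fun p hp => ?_) (by rw [mul_sub, hu, sub_self])
    rw [mul_sub, mul_left_comm, hy p hp, mul_left_comm, hx p hp, mul_zero, mul_zero, sub_zero]
  obtain ⟨v, w, hw, hvw⟩ := Ideal.IsMaximal.exists_inv ‹m.IsMaximal› s.2
  refine ⟨v * a, ?_⟩
  rw [sub_eq_zero] at h₂
  calc y = (v * s + w) * y := by rw [hvw, one_mul]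
    _ = v * (s * y) + w * y := by ring
    _ = v * a * x := by rw [h₂, hy w hw]; ring

/-- Every nonzero element of an artinian ring has a nonzero multiple killed by a maximal ideal. -/
theorem exists_mul_ne_zero_killed {R : Type*} [CommRing R] [IsArtinianRing R] {y : R}
    (hy : y ≠ 0) : ∃ (m : Ideal R) (a : R), m.IsMaximal ∧ a * y ≠ 0 ∧ ∀ p ∈ m, p * (a * y) = 0 := by
  obtain ⟨m, hm, -⟩ := exists_le_isAssociatedPrime_of_isNoetherianRing R
    (⟨y, Ideal.mem_span_singleton_self y⟩ : Ideal.span {y}) (fun h => hy (congrArg Subtype.val h))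
  obtain ⟨hprime, ⟨x, hx⟩, hmx⟩ := isAssociatedPrime_iff.mp hm
  obtain ⟨a, rfl⟩ := Ideal.mem_span_singleton'.mp hx
  have hmem (p : R) : p ∈ m ↔ p * (a * y) = 0 := by
    rw [hmx, Submodule.mem_colon_singleton, Submodule.mem_bot, ← Subtype.coe_inj]
    rfl
  -- m is the annihilator of a * y, an associated prime, and primes of an artinian ring are maximal.
  refine ⟨m, a, inferInstance, fun h => hprime.ne_top ((Ideal.eq_top_iff_one _).mpr ?_),
    fun p hp => (hmem p).mp hp⟩
  rw [hmem, h, mul_zero]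

end Socle

/-! ### Nilpotent coordinates and homogeneous ideals -/

section Components

variable {σ A : Type u} [CommRing A] {I : Ideal (MvPolynomial σ A)}

/-- `I` contains the homogeneous components of its elements. -/
def ContainsComponents (I : Ideal (MvPolynomial σ A)) : Prop :=
  ∀ s ∈ I, ∀ d, MvPolynomial.homogeneousComponent d s ∈ I

theorem finite_monomial_notMem [Finite σ] (hI : ∀ j, ∃ N, MvPolynomial.X j ^ N ∈ I) :
    {a : σ →₀ ℕ | MvPolynomial.monomial a 1 ∉ I}.Finite := by
  choose N hN using hI
  classical
  refine (Set.finite_Icc 0 (Finsupp.equivFunOnFinite.symm N)).subset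
    fun a ha => ⟨zero_le, fun j => ?_⟩
  by_contra hj
  rw [not_le, Finsupp.equivFunOnFinite_symm_apply_apply] at hj
  refine ha ?_
  have h : MvPolynomial.monomial a (1 : A) =
      MvPolynomial.X j ^ N j * MvPolynomial.monomial (a - Finsupp.single j (N j)) 1 := by
    rw [MvPolynomial.X_pow_eq_monomial, MvPolynomial.monomial_mul, one_mul,
      add_tsub_cancel_of_le (Finsupp.single_le_iff.mpr hj.le)]
  exact h ▸ I.mul_mem_right _ (hN j)

theorem isPolynomial_of_vanishes [Finite σ] (hI : ∀ j, ∃ N, MvPolynomial.X j ^ N ∈ I)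
    {F : DPSeries σ A} (hF : ∀ s ∈ I, F s = 0) : IsPolynomial F :=
  (finite_monomial_notMem hI).subset fun _ ha h => ha (hF _ h)

/-- Coordinates that are nilpotent on all geometric fibres are nilpotent. -/
theorem exists_X_pow_mem (hI : ∀ (L : Type u) [Field L] (g : A →+* L) (j : σ),
    ∃ N, MvPolynomial.X j ^ N ∈ I.map (MvPolynomial.map g)) (j : σ) :
    ∃ N, MvPolynomial.X j ^ N ∈ I := by
  suffices h : MvPolynomial.X j ∈ I.radical from h
  rw [Ideal.radical_eq_sInf, Ideal.mem_sInf]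
  rintro q ⟨hq, hqp⟩
  -- The prime q is a κ(q)-point e of the family base changed to κ(q); a coordinate nilpotent there
  -- takes the value zero at e.
  let h := algebraMap (MvPolynomial σ A) q.ResidueField
  obtain ⟨N, hN⟩ := hI q.ResidueField (h.comp MvPolynomial.C) j
  let e := MvPolynomial.eval₂Hom (RingHom.id q.ResidueField) fun j => h (MvPolynomial.X j)
  have he : e.comp (MvPolynomial.map (h.comp MvPolynomial.C)) = h := by
    ext <;> simp [e]
  have hle : I.map (MvPolynomial.map (h.comp MvPolynomial.C)) ≤ RingHom.ker e := by
    rw [Ideal.map_le_iff_le_comap]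
    intro s hs
    rw [Ideal.mem_comap, RingHom.mem_ker, ← RingHom.comp_apply, he]
    exact Ideal.algebraMap_residueField_eq_zero.mpr (hq hs)
  have h₁ := hle hN
  rw [RingHom.mem_ker, map_pow] at h₁
  have h₂ : h (MvPolynomial.X j) = 0 := by simpa [e] using eq_zero_of_pow_eq_zero h₁
  exact Ideal.algebraMap_residueField_eq_zero.mp h₂

/-- Over a reduced base, a finite flat family with homogeneous fibres is homogeneous. -/
theorem containsComponents_of_fibres [IsNoetherianRing A] [IsReduced A]
    [Module.Finite A (MvPolynomial σ A ⧸ I)] [Module.Flat A (MvPolynomial σ A ⧸ I)]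
    (hI : ∀ p : Ideal A, p.IsPrime → ∃ (L : Type u) (_ : Field L) (g : A →+* L),
      RingHom.ker g ≤ p ∧ ContainsComponents (I.map (MvPolynomial.map g))) :
    ContainsComponents I := by
  intro s hs d
  have := Module.finitePresentation_of_finite A (MvPolynomial σ A ⧸ I)
  have := Module.Flat.projective_of_finitePresentation (R := A) (M := MvPolynomial σ A ⧸ I)
  rw [← Ideal.Quotient.eq_zero_iff_mem, ← Module.forall_dual_apply_eq_zero_iff A]
  intro φ
  let F : DPSeries σ A := φ ∘ₗ (Ideal.Quotient.mkₐ A I).toLinearMap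
  have hF : ∀ s ∈ I, F s = 0 := fun s hs => by simp [F, Ideal.Quotient.eq_zero_iff_mem.mpr hs]
  change F _ = 0
  -- The value dies in a field L with ker g ≤ p for every prime p, so it is nilpotent, and A is
  -- reduced.
  refine IsNilpotent.eq_zero (nilpotent_iff_mem_prime.mpr fun p hp => ?_)
  obtain ⟨L, _, g, hgp, hg⟩ := hI p hp
  refine hgp ?_
  rw [RingHom.mem_ker, ← map_apply_map, ← homogeneousComponent_map]
  exact map_vanishes g hF _ (hg _ (Ideal.mem_map_of_mem _ hs) d)

theorem aeval_smul_X_monomial (c : A) (a : σ →₀ ℕ) (r : A) :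
    MvPolynomial.aeval (fun j => MvPolynomial.C c * MvPolynomial.X j) (MvPolynomial.monomial a r) =
      MvPolynomial.C (c ^ a.degree) * MvPolynomial.monomial a r := by
  rw [MvPolynomial.aeval_monomial, MvPolynomial.monomial_eq, MvPolynomial.algebraMap_eq]
  simp only [mul_pow, Finsupp.prod_mul]
  rw [show (a.prod fun _ n => (MvPolynomial.C c : MvPolynomial σ A) ^ n) =
    MvPolynomial.C (c ^ a.degree) by
      rw [Finsupp.prod, Finset.prod_pow_eq_pow_sum, map_pow]; rfl]
  ring

theorem aeval_smul_X_of_isHomogeneous (c : A) {d : ℕ} {s : MvPolynomial σ A}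
    (hs : s.IsHomogeneous d) :
    MvPolynomial.aeval (fun j => MvPolynomial.C c * MvPolynomial.X j) s =
      MvPolynomial.C (c ^ d) * s := by
  rw [s.as_sum, map_sum, Finset.mul_sum]
  refine Finset.sum_congr rfl fun a ha => ?_
  rw [aeval_smul_X_monomial, Finsupp.degree_eq_weight_one,
    ← hs (MvPolynomial.mem_support_iff.mp ha)]
  rfl

/-- An ideal invariant under the dilations by an infinite field is homogeneous. -/
theorem containsComponents_of_dilation {k K : Type u} [Field k] [Infinite k] [Field K]
    (f : k →+* K) {J : Ideal (MvPolynomial σ K)}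
    (hJ : ∀ (c : kˣ), ∀ s ∈ J, MvPolynomial.aeval
      (fun j => MvPolynomial.C (f c) * MvPolynomial.X j) s ∈ J) : ContainsComponents J := by
  intro s hs d
  rw [← Ideal.Quotient.eq_zero_iff_mem, ← Module.forall_dual_apply_eq_zero_iff K]
  intro φ
  let F : DPSeries σ K := φ ∘ₗ (Ideal.Quotient.mkₐ K J).toLinearMap
  change F _ = 0
  -- P evaluated at f c is F of the dilate of s by c, so P has infinitely many roots and its
  -- coefficients, the values of F on the components, vanish.
  let P : Polynomial K := ∑ i ∈ Finset.range (s.totalDegree + 1),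
    Polynomial.monomial i (F (MvPolynomial.homogeneousComponent i s))
  have hP : P = 0 := by
    refine P.eq_zero_of_infinite_isRoot (Set.Infinite.mono ?_
      ((Set.finite_singleton (0 : k)).infinite_compl.image f.injective.injOn))
    rintro _ ⟨c, hc, rfl⟩
    obtain ⟨c, rfl⟩ := isUnit_iff_ne_zero.mpr hc
    have h : F (MvPolynomial.aeval (fun j => MvPolynomial.C (f c) * MvPolynomial.X j) s) = 0 :=
      (congrArg φ (Ideal.Quotient.eq_zero_iff_mem.mpr (hJ c s hs))).trans (map_zero φ)
    rw [← s.sum_homogeneousComponent, map_sum, map_sum] at h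
    simp only [Set.mem_ofPred_eq, Polynomial.IsRoot.def, P, Polynomial.eval_finsetSum,
      Polynomial.eval_monomial]
    rw [← h]
    refine Finset.sum_congr rfl fun i _ => ?_
    rw [aeval_smul_X_of_isHomogeneous _ (MvPolynomial.homogeneousComponent_isHomogeneous i s),
      ← MvPolynomial.smul_eq_C_mul, map_smul, smul_eq_mul, mul_comm]
  by_cases hd : d < s.totalDegree + 1
  · have h := congrArg (fun p => p.coeff d) hP
    simpa [P, Polynomial.finsetSum_coeff, Polynomial.coeff_monomial, hd] using h
  · rw [MvPolynomial.homogeneousComponent_eq_zero _ _ (by omega), map_zero]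

end Components

/-! ### Apolar generators over a field -/

section FieldCase

variable {σ K : Type u} [Field K] {J : Ideal (MvPolynomial σ K)}

/-- Over an infinite field, a finite algebra with simple socles is apolar. -/
theorem exists_ann_eq [Infinite K] [Module.Finite K (MvPolynomial σ K ⧸ J)]
    (hJ : HasSimpleSocles (MvPolynomial σ K ⧸ J)) : ∃ F : DPSeries σ K, ann F = J := by
  have : IsArtinianRing (MvPolynomial σ K ⧸ J) := IsArtinianRing.of_finite K _
  let ι := {m : MaximalSpectrum (MvPolynomial σ K ⧸ J) // ∃ x ≠ 0, ∀ p ∈ m.asIdeal, p * x = 0}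
  choose x hx0 hx using fun m : ι => m.2
  -- One nonzero socle element is chosen for each relevant maximal ideal. Over an infinite field,
  -- finitely many hyperplanes do not cover the dual.
  obtain ⟨φ, hφ⟩ := Module.exists_dual_forall_apply_ne_zero (K := K) x hx0
  have hF : ∀ s ∈ J, (φ ∘ₗ (Ideal.Quotient.mkₐ K J).toLinearMap) s = 0 := fun s hs => by
    simp [Ideal.Quotient.eq_zero_iff_mem.mpr hs]
  refine ⟨φ ∘ₗ (Ideal.Quotient.mkₐ K J).toLinearMap, le_antisymm (fun s hs => ?_)
    (le_ann_of_vanishes hF)⟩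
  by_contra hsJ
  have hs0 : Ideal.Quotient.mk J s ≠ 0 := fun h => hsJ (Ideal.Quotient.eq_zero_iff_mem.mp h)
  obtain ⟨m, a, hm, ha0, ha⟩ := exists_mul_ne_zero_killed hs0
  let i : ι := ⟨⟨m, hm⟩, _, ha0, ha⟩
  obtain ⟨r, hr⟩ := hJ m hm _ (x i) ha0 ha (hx i)
  obtain ⟨t, ht⟩ := Ideal.Quotient.mk_surjective (r * a)
  refine hφ i ?_
  have := mem_ann.mp hs t
  rw [hr, ← mul_assoc, ← ht, mul_comm, ← map_mul]
  exact this

/-- A homogeneous ideal of finite codimension contains powers of the coordinates. -/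
theorem exists_X_pow_mem_of_containsComponents [Module.Finite K (MvPolynomial σ K ⧸ J)]
    (hJ : ContainsComponents J) (j : σ) : ∃ N, MvPolynomial.X j ^ N ∈ J := by
  obtain ⟨p, hp, hp0⟩ : ∃ p : Polynomial K, p.Monic ∧
      Polynomial.aeval (Ideal.Quotient.mk J (MvPolynomial.X j)) p = 0 :=
    Algebra.IsIntegral.isIntegral _
  have hmem : Polynomial.aeval (MvPolynomial.X j) p ∈ J := by
    rw [← Ideal.Quotient.eq_zero_iff_mem, ← hp0]
    exact (Polynomial.aeval_algHom_apply (Ideal.Quotient.mkₐ K J) _ p).symm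
  refine ⟨p.natDegree, ?_⟩
  -- The top component of a monic relation in X j is the leading power alone.
  have h := hJ _ hmem p.natDegree
  rw [Polynomial.aeval_eq_sum_range, map_sum, Finset.sum_eq_single p.natDegree] at h
  · rwa [hp.coeff_natDegree, one_smul, MvPolynomial.X_pow_eq_monomial,
      homogeneousComponent_monomial, if_pos (Finsupp.degree_single _ _),
      ← MvPolynomial.X_pow_eq_monomial] at h
  · intro i _ hi
    rw [map_smul, MvPolynomial.X_pow_eq_monomial, homogeneousComponent_monomial,
      if_neg (by rwa [Finsupp.degree_single]), smul_zero]
  · simp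

theorem sub_C_mem_of_X_mem {I : Ideal (MvPolynomial σ K)} (hI : ∀ j, MvPolynomial.X j ∈ I)
    (s : MvPolynomial σ K) : s - MvPolynomial.C (MvPolynomial.constantCoeff s) ∈ I := by
  induction s using MvPolynomial.induction_on with
  | C a => simp
  | add p q hp hq =>
    rw [map_add, map_add, add_sub_add_comm]
    exact I.add_mem hp hq
  | mul_X p j _ => simpa using I.mul_mem_left p (hI j)

/-- A homogeneous ideal of finite codimension with simple socles is the apolar ideal of a
homogeneous polynomial. -/
theorem exists_isHomogeneous_ann_eq [Finite σ] [Module.Finite K (MvPolynomial σ K ⧸ J)]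
    (hJ : HasSimpleSocles (MvPolynomial σ K ⧸ J)) (hJh : ContainsComponents J) :
    ∃ (F : DPSeries σ K) (d : ℕ), IsHomogeneous F d ∧ ann F = J := by
  have : IsArtinianRing (MvPolynomial σ K ⧸ J) := IsArtinianRing.of_finite K _
  rcases eq_or_ne J ⊤ with rfl | hJtop
  · exact ⟨0, 0, fun _ _ => rfl, eq_top_iff.mpr fun s _ => mem_ann.mpr fun t => rfl⟩
  have hX := exists_X_pow_mem_of_containsComponents hJh
  -- A monomial of maximal degree outside J is killed by all variables, hence is a socle element.
  obtain ⟨a, ha, hmax⟩ := Set.exists_max_image {a : σ →₀ ℕ | MvPolynomial.monomial a 1 ∉ J}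
    Finsupp.degree (finite_monomial_notMem hX) ⟨0, (Ideal.ne_top_iff_one J).mp hJtop⟩
  set z := Ideal.Quotient.mk J (MvPolynomial.monomial a 1) with hz
  have hz0 : z ≠ 0 := fun h => ha (Ideal.Quotient.eq_zero_iff_mem.mp h)
  have hXz (j : σ) : MvPolynomial.X j * MvPolynomial.monomial a 1 ∈ J := by
    rw [MvPolynomial.X, MvPolynomial.monomial_mul, one_mul]
    by_contra h
    have := hmax _ h
    rw [map_add, Finsupp.degree_single] at this
    omega
  -- The variables are nilpotent modulo J, so they lie in m, and elements of m have zero constant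
  -- term.
  have hkill (m : Ideal (MvPolynomial σ K ⧸ J)) (hm : m.IsMaximal) : ∀ p ∈ m, p * z = 0 := by
    intro p hp
    obtain ⟨s, rfl⟩ := Ideal.Quotient.mk_surjective p
    have hXm (j : σ) : MvPolynomial.X j ∈ m.comap (Ideal.Quotient.mk J) := by
      obtain ⟨N, hN⟩ := hX j
      refine hm.isPrime.mem_of_pow_mem N ?_
      rw [← map_pow, Ideal.Quotient.eq_zero_iff_mem.mpr hN]
      exact m.zero_mem
    have hC : MvPolynomial.C (MvPolynomial.constantCoeff s) ∈ m.comap (Ideal.Quotient.mk J) := by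
      have := Ideal.sub_mem _ (show s ∈ m.comap (Ideal.Quotient.mk J) from hp)
        (sub_C_mem_of_X_mem hXm s)
      simpa using this
    have hs0 : MvPolynomial.constantCoeff s = 0 := by
      by_contra h
      exact hm.ne_top (Ideal.eq_top_of_isUnit_mem _ hC
        (((isUnit_iff_ne_zero.mpr h).map MvPolynomial.C).map (Ideal.Quotient.mk J)))
    have hs := sub_C_mem_of_X_mem (I := J.colon {MvPolynomial.monomial a 1})
      (fun j => Submodule.mem_colon_singleton.mpr (hXz j)) s
    rw [hs0, map_zero, sub_zero] at hs
    rw [hz, ← map_mul]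
    exact Ideal.Quotient.eq_zero_iff_mem.mpr (Submodule.mem_colon_singleton.mp hs)
  obtain ⟨φ, hφ⟩ : ∃ φ : Module.Dual K (MvPolynomial σ K ⧸ J), φ z ≠ 0 := by
    by_contra! h
    exact hz0 ((Module.forall_dual_apply_eq_zero_iff K z).mp h)
  let F : DPSeries σ K := φ ∘ₗ (Ideal.Quotient.mkₐ K J).toLinearMap
  have hF : ∀ s ∈ J, F s = 0 := fun s hs => by simp [F, Ideal.Quotient.eq_zero_iff_mem.mpr hs]
  -- Passing to the degree of the socle monomial keeps the nonzero value φ z there.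
  have hF' := homogeneousPart_vanishes (d := a.degree) hJh hF
  refine ⟨homogeneousPart a.degree F, a.degree, isHomogeneous_homogeneousPart _ _,
    le_antisymm (fun s hs => ?_) (le_ann_of_vanishes hF')⟩
  by_contra hsJ
  have hs0 : Ideal.Quotient.mk J s ≠ 0 := fun h => hsJ (Ideal.Quotient.eq_zero_iff_mem.mp h)
  obtain ⟨m, b, hm, hb0, hb⟩ := exists_mul_ne_zero_killed hs0
  obtain ⟨r, hr⟩ := hJ m hm _ z hb0 hb (hkill m hm)
  obtain ⟨t, ht⟩ := Ideal.Quotient.mk_surjective (r * b)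
  rw [← mul_assoc, ← ht, hz, ← map_mul, Ideal.Quotient.eq] at hr
  have h₁ := hF' _ hr
  rw [map_sub, mul_comm, mem_ann.mp hs t, sub_zero, homogeneousPart, LinearMap.comp_apply,
    homogeneousComponent_monomial, if_pos rfl] at h₁
  exact hφ h₁

end FieldCase

noncomputable section

/-! ### Families as ideals, and their base change -/

section CutOut

variable {σ : Type u}

/-- The closed subscheme of `𝔸^σ` over `Spec A` defined by an ideal of `A[α]`. -/
def idealι {A : CommRingCat.{u}} (I : Ideal (MvPolynomial σ A)) :
    Spec (.of (MvPolynomial σ A ⧸ I)) ⟶ 𝔸(σ; Spec A) :=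
  Spec.map (CommRingCat.ofHom (Ideal.Quotient.mk I)) ≫ (AffineSpace.SpecIso σ A).inv

variable {X T : Scheme.{u}} (i : X ⟶ 𝔸(σ; T))

/-- The base change of the family to `Spec A` is the closed subscheme defined by `I`. -/
def IsCutOutBy {A : CommRingCat.{u}} (g : Spec A ⟶ T) (I : Ideal (MvPolynomial σ A)) : Prop :=
  ∃ h : Spec (.of (MvPolynomial σ A ⧸ I)) ⟶ X, IsPullback h (idealι I) i (AffineSpace.map σ g)

variable {i} {A : CommRingCat.{u}} {g : Spec A ⟶ T} {I : Ideal (MvPolynomial σ A)}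

theorem IsCutOutBy.exists_iso (h : IsCutOutBy i g I) :
    ∃ e : baseChange i g ≅ Spec (.of (MvPolynomial σ A ⧸ I)),
      e.hom ≫ idealι I = baseChangeι i g := by
  obtain ⟨h, hh⟩ := h
  exact ⟨hh.isoPullback.symm, hh.isoPullback_inv_snd⟩

theorem exists_isCutOutBy [IsClosedImmersion i] (g : Spec A ⟶ T) : ∃ I, IsCutOutBy i g I := by
  have : IsClosedImmersion (pullback.snd i (AffineSpace.map σ g)) :=
    MorphismProperty.of_isPullback (IsPullback.of_hasPullback i (AffineSpace.map σ g)) ‹_›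
  obtain ⟨I, e, he⟩ := IsClosedImmersion.Spec_iff.mp (inferInstance : IsClosedImmersion
    (pullback.snd i (AffineSpace.map σ g) ≫ (AffineSpace.SpecIso σ A).hom))
  let e' : pullback i (AffineSpace.map σ g) ≅ Spec (.of (MvPolynomial σ A ⧸ I)) := e
  have he' : e'.inv ≫ pullback.snd i (AffineSpace.map σ g) = idealι I := by
    rw [Iso.inv_comp_eq, ← cancel_mono (AffineSpace.SpecIso σ A).hom, he, idealι, Category.assoc,
      Category.assoc, Iso.inv_hom_id, Category.comp_id]
  refine ⟨I, e'.inv ≫ pullback.fst i (AffineSpace.map σ g),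
    IsPullback.of_iso_pullback ⟨?_⟩ e'.symm rfl he'⟩
  rw [← he', Category.assoc, Category.assoc, pullback.condition]

theorem isPushout_quotient {R S : CommRingCat.{u}} (f : R ⟶ S) (I : Ideal R) :
    IsPushout (CommRingCat.ofHom (Ideal.Quotient.mk I)) f
      (CommRingCat.ofHom (Ideal.quotientMap (I.map f.hom) f.hom Ideal.le_comap_map))
      (CommRingCat.ofHom (Ideal.Quotient.mk (I.map f.hom))) := by
  refine ⟨⟨rfl⟩, ⟨PushoutCocone.IsColimit.mk _
    (fun s => CommRingCat.ofHom (Ideal.Quotient.lift (I.map f.hom) s.inr.hom ?_)) ?_ ?_ ?_⟩⟩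
  · intro a ha
    have hle : I.map f.hom ≤ RingHom.ker s.inr.hom := by
      rw [Ideal.map_le_iff_le_comap]
      intro r hr
      have h := congrArg (fun q => q.hom r) s.condition
      rw [Ideal.mem_comap, RingHom.mem_ker]
      refine h.symm.trans ?_
      change s.inl.hom (Ideal.Quotient.mk I r) = 0
      rw [Ideal.Quotient.eq_zero_iff_mem.mpr hr, map_zero]
    exact hle ha
  · intro s
    ext r
    exact (congrArg (fun q => q.hom r) s.condition).symm
  · intro s
    rfl
  · intro s m _ h₂
    ext r
    exact congrArg (fun q => q.hom r) h₂

/-- Quotients commute with base change: the pushout square of the quotient is pasted with the base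
change square of affine space. -/
theorem IsCutOutBy.map {A' : CommRingCat.{u}} (h : IsCutOutBy i g I) (f : A ⟶ A')
    {g' : Spec A' ⟶ T} (hg : Spec.map f ≫ g = g') :
    IsCutOutBy i g' (I.map (MvPolynomial.map f.hom)) := by
  obtain ⟨h, hh⟩ := h
  subst hg
  have h₁ := isPullback_SpecMap_of_isPushout _ _ _ _
    (isPushout_quotient (CommRingCat.ofHom (MvPolynomial.map (σ := σ) f.hom)) I)
  have h₂ : IsPullback (Spec.map (CommRingCat.ofHom (MvPolynomial.map (σ := σ) f.hom)))
      (AffineSpace.SpecIso σ A').inv (AffineSpace.SpecIso σ A).inv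
      (AffineSpace.map σ (Spec.map f)) :=
    IsPullback.of_vert_isIso ⟨by rw [AffineSpace.map_SpecMap, Iso.inv_hom_id_assoc]⟩
  refine ⟨Spec.map (CommRingCat.ofHom (Ideal.quotientMap (I.map (MvPolynomial.map f.hom))
    (MvPolynomial.map f.hom) Ideal.le_comap_map)) ≫ h, ?_⟩
  rw [AffineSpace.map_comp]
  exact IsPullback.paste_horiz (h₁.paste_vert h₂) hh

/-- The ring map of a family cut out by an ideal is a base change of the family. -/
theorem IsCutOutBy.isPullback (h : IsCutOutBy i g I) :
    ∃ h : Spec (.of (MvPolynomial σ A ⧸ I)) ⟶ X, IsPullback h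
      (Spec.map (CommRingCat.ofHom (algebraMap A (MvPolynomial σ A ⧸ I)))) (i ≫ (𝔸(σ; T) ↘ T)) g := by
  obtain ⟨h, hh⟩ := h
  refine ⟨h, ?_⟩
  have h₁ := hh.paste_vert (AffineSpace.isPullback_map g)
  rwa [idealι, Category.assoc, AffineSpace.SpecIso_inv_over, ← Spec.map_comp] at h₁

theorem IsCutOutBy.finite (h : IsCutOutBy i g I) (hi : IsFinite (i ≫ (𝔸(σ; T) ↘ T))) :
    Module.Finite A (MvPolynomial σ A ⧸ I) := by
  obtain ⟨_, hh⟩ := h.isPullback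
  have := MorphismProperty.of_isPullback hh hi
  rw [IsFinite.SpecMap_iff] at this
  exact RingHom.finite_algebraMap.mp this

theorem IsCutOutBy.flat (h : IsCutOutBy i g I) (hi : Flat (i ≫ (𝔸(σ; T) ↘ T))) :
    Module.Flat A (MvPolynomial σ A ⧸ I) := by
  obtain ⟨_, hh⟩ := h.isPullback
  have := MorphismProperty.of_isPullback hh hi
  rw [HasRingHomProperty.Spec_iff (P := @Flat)] at this
  exact RingHom.flat_algebraMap_iff.mp this

theorem IsCutOutBy.eqApolarOver {U : T.Opens} (hU : IsAffineOpen U) {F : DPSeries σ Γ(T, U)}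
    (h : IsCutOutBy i hU.fromSpec (ann F)) : EqApolarOver i hU F :=
  h.exists_iso

end CutOut

/-! ### Geometric conditions on fibres in terms of ideals -/

section Fibres

/-- Through e, the stalk at z is the localization of R at the matching prime, so its socle controls
the part of R killed by m. -/
theorem hasSimpleSocles_of_iso {Y : Scheme.{u}} {R : CommRingCat.{u}} (e : Y ≅ Spec R)
    (h : ∀ z : Y, IsGorensteinArtinLocal (Y.presheaf.stalk z)) : HasSimpleSocles R := by
  intro m hm x y hx0 hx hy
  obtain ⟨z, rfl⟩ : ∃ z, (e.hom z).asIdeal = m := by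
    let p : Spec R := ⟨m, hm.isPrime⟩
    refine ⟨e.inv p, ?_⟩
    rw [← Scheme.Hom.comp_apply, Iso.inv_hom_id]
    rfl
  let φ : (Spec R).presheaf.stalk (e.hom z) ≅ Y.presheaf.stalk z := asIso (e.hom.stalkMap z)
  let _ : Algebra R ((Spec R).presheaf.stalk (e.hom z)) := StructureSheaf.stalkAlgebra R (e.hom z)
  have hprime : (e.hom z).asIdeal.IsPrime := PrimeSpectrum.isPrime (e.hom z)
  have hloc : IsLocalization.AtPrime ((Spec R).presheaf.stalk (e.hom z)) (e.hom z).asIdeal :=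
    StructureSheaf.IsLocalization.to_stalk R (e.hom z)
  let _ : Algebra R (Y.presheaf.stalk z) :=
    (φ.hom.hom.comp (algebraMap R ((Spec R).presheaf.stalk (e.hom z)))).toAlgebra
  let ε : (Spec R).presheaf.stalk (e.hom z) ≃ₐ[R] Y.presheaf.stalk z :=
    AlgEquiv.ofRingEquiv (f := φ.commRingCatIsoToRingEquiv) fun _ => rfl
  have hloc' : IsLocalization.AtPrime (Y.presheaf.stalk z) (e.hom z).asIdeal :=
    IsLocalization.isLocalization_of_algEquiv _ ε
  exact exists_eq_mul_of_isLocalization (S := Y.presheaf.stalk z) _ (h z) hx0 hx hy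

variable {σ : Type u} {X T : Scheme.{u}} {i : X ⟶ 𝔸(σ; T)}

theorem evaluation_fromSpec {U : T.Opens} (hU : IsAffineOpen U) {t : T} (ht : t ∈ U) :
    Spec.map (T.evaluation U t ht) ≫ hU.fromSpec = T.fromSpecResidueField t := by
  rw [Scheme.evaluation, Spec.map_comp, Category.assoc, Scheme.fromSpecResidueField,
    ← hU.fromSpecStalk_eq_fromSpecStalk ht]
  rfl

/-- Every field-valued point of an affine open factors through a residue field. -/
theorem exists_evaluation_comp {U : T.Opens} (hU : IsAffineOpen U) {L : Type u} [Field L]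
    (g : Γ(T, U) →+* L) : ∃ (t : T) (ht : t ∈ U) (φ : T.residueField t ⟶ .of L),
      T.evaluation U t ht ≫ φ = CommRingCat.ofHom g := by
  obtain ⟨⟨t, φ⟩, hφ⟩ := (Scheme.SpecToEquivOfField L T).symm.surjective
    (Spec.map (CommRingCat.ofHom g) ≫ hU.fromSpec)
  change Spec.map φ ≫ T.fromSpecResidueField t = _ at hφ
  have ht : t ∈ U := by
    let x : Spec (.of L) := IsLocalRing.closedPoint L
    have h : (Spec.map φ ≫ T.fromSpecResidueField t) x =
        (Spec.map (CommRingCat.ofHom g) ≫ hU.fromSpec) x := by rw [hφ]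
    rw [Scheme.Hom.comp_apply, Scheme.Hom.comp_apply, Scheme.fromSpecResidueField_apply] at h
    rw [h, ← SetLike.mem_coe, ← hU.range_fromSpec]
    exact Set.mem_range_self _
  refine ⟨t, ht, φ, Spec.map_injective ?_⟩
  rw [← cancel_mono hU.fromSpec, ← hφ, Spec.map_comp, Category.assoc, evaluation_fromSpec hU ht]

/-- A closed point gives a closed immersion of Spec κ(t) into T, hence into the affine open, where
this means surjectivity on rings. -/
theorem evaluation_surjective {U : T.Opens} (hU : IsAffineOpen U) {t : T} (ht : t ∈ U)
    (hc : IsClosed {t}) : Function.Surjective (T.evaluation U t ht) := by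
  have h := isClosed_singleton_iff_isClosedImmersion.mp hc
  rw [← evaluation_fromSpec hU ht] at h
  have := IsClosedImmersion.of_comp (Spec.map (T.evaluation U t ht)) hU.fromSpec
  obtain ⟨-, h₁⟩ := IsClosedImmersion.isAffine_surjective_of_isAffine
    (Spec.map (T.evaluation U t ht))
  intro y
  obtain ⟨x, hx⟩ := h₁ ((Scheme.ΓSpecIso _).inv y)
  refine ⟨(Scheme.ΓSpecIso _).hom x, ?_⟩
  rw [← CommRingCat.comp_apply, ← Scheme.ΓSpecIso_naturality, CommRingCat.comp_apply, hx,
    ← CommRingCat.comp_apply, Iso.inv_hom_id]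
  rfl

/-- The open set where the j-th coordinate is invertible misses the origin, so it is empty on the
fibre; on an affine scheme this says the coordinate is nilpotent. -/
theorem exists_X_pow_mem_of_supportedAtOrigin {t : T}
    {J : Ideal (MvPolynomial σ (T.residueField t))}
    (hJ : IsCutOutBy i (T.fromSpecResidueField t) J) (h : FibreSupportedAtOrigin i t) (j : σ) :
    ∃ N, MvPolynomial.X j ^ N ∈ J := by
  obtain ⟨e, he⟩ := hJ.exists_iso
  have hinv : (idealι J).appTop (AffineSpace.coord _ j) =
      (Scheme.ΓSpecIso _).inv (Ideal.Quotient.mk J (MvPolynomial.X j)) := by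
    rw [idealι, Scheme.Hom.comp_appTop, CommRingCat.comp_apply, AffineSpace.SpecIso_inv_appTop_coord,
      ← CommRingCat.comp_apply, ← Scheme.ΓSpecIso_inv_naturality]
    rfl
  let D := 𝔸(σ; Spec (T.residueField t)).basicOpen (AffineSpace.coord _ j)
  have hD : origin σ _ ⁻¹ᵁ D = ⊥ := by
    rw [Scheme.preimage_basicOpen_top, origin, AffineSpace.homOfVector_appTop_coord,
      Scheme.basicOpen_zero]
  have hbot : PrimeSpectrum.basicOpen (Ideal.Quotient.mk J (MvPolynomial.X j)) = ⊥ := by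
    have h₁ : idealι J ⁻¹ᵁ D = ⊥ := by
      rw [eq_bot_iff]
      intro x hx
      obtain ⟨y, hy⟩ := h ⟨e.inv x, show baseChangeι i _ (e.inv x) = idealι J x by
        rw [← Scheme.Hom.comp_apply, ← he, Iso.inv_hom_id_assoc]⟩
      have hy' : y ∈ origin σ _ ⁻¹ᵁ D := show origin σ _ y ∈ D from hy ▸ hx
      rw [hD] at hy'
      exact hy'.elim
    rw [Scheme.preimage_basicOpen_top, hinv, basicOpen_eq_of_affine] at h₁
    exact h₁
  rw [PrimeSpectrum.basicOpen_eq_bot_iff] at hbot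
  obtain ⟨N, hN⟩ := hbot
  exact ⟨N, Ideal.Quotient.eq_zero_iff_mem.mp (by rwa [map_pow])⟩

theorem inv_dilation {k : Type u} [Field k] {K : CommRingCat.{u}} (f : CommRingCat.of k ⟶ K) (c : k) :
    (AffineSpace.SpecIso σ K).inv ≫ dilation σ (Spec.map f) c =
      Spec.map (CommRingCat.ofHom (MvPolynomial.aeval (R := K)
        fun j : σ => MvPolynomial.C (f.hom c) * MvPolynomial.X j).toRingHom) ≫
      (AffineSpace.SpecIso σ K).inv := by
  apply AffineSpace.hom_ext
  · rw [Category.assoc, Category.assoc, dilation, AffineSpace.homOfVector_over,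
      AffineSpace.SpecIso_inv_over, ← Spec.map_comp]
    refine congrArg Spec.map (CommRingCat.hom_ext (RingHom.ext fun x => ?_))
    exact (MvPolynomial.aeval_C (fun j : σ => MvPolynomial.C (f.hom c) * MvPolynomial.X j)
      x).symm
  · intro j
    have hc : (AffineSpace.SpecIso σ K).inv.appTop (((𝔸(σ; Spec K) ↘ Spec K) ≫ Spec.map f).appTop
        ((Scheme.ΓSpecIso (.of k)).inv c)) =
        (Scheme.ΓSpecIso (.of (MvPolynomial σ K))).inv (MvPolynomial.C (f.hom c)) := by
      rw [← CommRingCat.comp_apply, ← Scheme.Hom.comp_appTop, AffineSpace.SpecIso_inv_over_assoc,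
        ← Spec.map_comp, ← CommRingCat.comp_apply, ← Scheme.ΓSpecIso_inv_naturality]
      rfl
    rw [Scheme.Hom.comp_appTop, Scheme.Hom.comp_appTop, CommRingCat.comp_apply,
      CommRingCat.comp_apply, AffineSpace.SpecIso_inv_appTop_coord, dilation,
      AffineSpace.homOfVector_appTop_coord, map_mul, AffineSpace.SpecIso_inv_appTop_coord,
      hc, ← map_mul, ← CommRingCat.comp_apply, ← Scheme.ΓSpecIso_inv_naturality,
      CommRingCat.comp_apply]
    exact congrArg _ (MvPolynomial.aeval_X
      (fun j : σ => MvPolynomial.C (f.hom c) * MvPolynomial.X j) j).symm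

/-- A self-map of the fibre over the dilation is a ring endomorphism of the quotient induced by α_j
↦ c α_j, so this substitution preserves J. -/
theorem containsComponents_of_dilationInvariant {k : Type u} [Field k] [Infinite k]
    (s : T ⟶ Spec (.of k)) {t : T} {J : Ideal (MvPolynomial σ (T.residueField t))}
    (hJ : IsCutOutBy i (T.fromSpecResidueField t) J) (h : FibreDilationInvariant i s t) :
    ContainsComponents J := by
  obtain ⟨e, he⟩ := hJ.exists_iso
  obtain ⟨f, hf⟩ := Spec.map_surjective (T.fromSpecResidueField t ≫ s)
  refine containsComponents_of_dilation f.hom fun c x hx => ?_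
  obtain ⟨φ, hφ⟩ := h c
  obtain ⟨φ', hφ'⟩ := Spec.map_surjective (e.inv ≫ φ ≫ e.hom)
  let δ := CommRingCat.ofHom (MvPolynomial.aeval (R := T.residueField t)
    fun j : σ => MvPolynomial.C (f.hom c) * MvPolynomial.X j).toRingHom
  have h₁ : CommRingCat.ofHom (Ideal.Quotient.mk J) ≫ φ' =
      δ ≫ CommRingCat.ofHom (Ideal.Quotient.mk J) := by
    apply Spec.map_injective
    rw [← cancel_mono (AffineSpace.SpecIso σ _).inv, Spec.map_comp, Spec.map_comp, Category.assoc,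
      Category.assoc, ← inv_dilation, hf, hφ']
    change (e.inv ≫ φ ≫ e.hom) ≫ idealι J = idealι J ≫ _
    rw [Category.assoc, Category.assoc, he, hφ, fibreι, ← he, Category.assoc,
      Iso.inv_hom_id_assoc]
  have h₂ := congrArg (fun q => q.hom x) h₁
  change φ'.hom (Ideal.Quotient.mk J x) = Ideal.Quotient.mk J (δ.hom x) at h₂
  rw [Ideal.Quotient.eq_zero_iff_mem.mpr hx, map_zero] at h₂
  exact Ideal.Quotient.eq_zero_iff_mem.mp h₂.symm

end Fibres

end

/-! ### Extension to a neighbourhood -/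

section Local

variable {σ : Type u} {X T : Scheme.{u}} {i : X ⟶ 𝔸(σ; T)} {U : T.Opens}
  {I : Ideal (MvPolynomial σ Γ(T, U))}

/-- If all fibres are supported at the origin, the coordinates are nilpotent on the family. -/
theorem IsCutOutBy.exists_X_pow_mem (hU : IsAffineOpen U) (hI : IsCutOutBy i hU.fromSpec I)
    (h : ∀ t : T, FibreSupportedAtOrigin i t) (j : σ) : ∃ N, MvPolynomial.X j ^ N ∈ I := by
  refine ApolarFamily.exists_X_pow_mem (fun L _ g j => ?_) j
  obtain ⟨t, ht, φ, hφ⟩ := exists_evaluation_comp hU g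
  obtain ⟨N, hN⟩ := exists_X_pow_mem_of_supportedAtOrigin
    (hI.map (T.evaluation U t ht) (evaluation_fromSpec hU ht)) (h t) j
  refine ⟨N, ?_⟩
  have h₁ := Ideal.mem_map_of_mem (MvPolynomial.map φ.hom) hN
  have h₂ : (MvPolynomial.map (σ := σ) φ.hom).comp (MvPolynomial.map (T.evaluation U t ht).hom) =
      MvPolynomial.map g := by
    have : g = φ.hom.comp (T.evaluation U t ht).hom := congrArg CommRingCat.Hom.hom hφ.symm
    rw [this]
    exact RingHom.ext fun p => MvPolynomial.map_map _ _ p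
  rwa [Ideal.map_map, h₂, map_pow, MvPolynomial.map_X] at h₁

/-- If `T` is reduced and all fibres are dilation invariant, the family is homogeneous. -/
theorem IsCutOutBy.containsComponents {k : Type u} [Field k] [Infinite k] {s : T ⟶ Spec (.of k)}
    [IsNoetherianRing Γ(T, U)] [IsReduced Γ(T, U)]
    [Module.Finite Γ(T, U) (MvPolynomial σ Γ(T, U) ⧸ I)]
    [Module.Flat Γ(T, U) (MvPolynomial σ Γ(T, U) ⧸ I)] (hU : IsAffineOpen U)
    (hI : IsCutOutBy i hU.fromSpec I) (h : ∀ t : T, FibreDilationInvariant i s t) :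
    ContainsComponents I := by
  refine containsComponents_of_fibres fun p hp => ?_
  obtain ⟨t, ht, φ, hφ⟩ := exists_evaluation_comp hU (algebraMap Γ(T, U) p.ResidueField)
  refine ⟨T.residueField t, inferInstance, (T.evaluation U t ht).hom, fun a ha => ?_,
    containsComponents_of_dilationInvariant s
      (hI.map (T.evaluation U t ht) (evaluation_fromSpec hU ht)) (h t)⟩
  have h₁ := congrArg (fun q => q.hom a) hφ
  change φ.hom ((T.evaluation U t ht).hom a) = algebraMap Γ(T, U) p.ResidueField a at h₁
  rw [RingHom.mem_ker.mp ha, map_zero] at h₁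
  exact Ideal.algebraMap_residueField_eq_zero.mp h₁.symm

theorem IsCutOutBy.hasSimpleSocles {t : T} {J : Ideal (MvPolynomial σ (T.residueField t))}
    (hJ : IsCutOutBy i (T.fromSpecResidueField t) J) (h : GorensteinFibre i t) :
    HasSimpleSocles (MvPolynomial σ (T.residueField t) ⧸ J) := by
  obtain ⟨e, -⟩ := hJ.exists_iso
  exact hasSimpleSocles_of_iso e h

/-- A dual generator of the fibre over a closed point extends to a neighbourhood. -/
theorem IsCutOutBy.exists_basicOpen [IsNoetherianRing Γ(T, U)]
    [Module.Finite Γ(T, U) (MvPolynomial σ Γ(T, U) ⧸ I)] (hU : IsAffineOpen U)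
    (hI : IsCutOutBy i hU.fromSpec I) {t : T} (ht : t ∈ U) (hc : IsClosed {t})
    {F : DPSeries σ Γ(T, U)} (hF : ∀ s ∈ I, F s = 0) {F₀ : DPSeries σ (T.residueField t)}
    (hF₀ : ann F₀ = I.map (MvPolynomial.map (T.evaluation U t ht).hom))
    (hFF₀ : ∀ s, (T.evaluation U t ht).hom (F s) =
      F₀ (MvPolynomial.map (T.evaluation U t ht).hom s)) :
    ∃ (V : T.Opens) (hV : IsAffineOpen V) (f : Γ(T, U) ⟶ Γ(T, V)), t ∈ V ∧
      ann (F.map f.hom) = I.map (MvPolynomial.map f.hom) ∧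
      EqApolarOver i hV (F.map f.hom) ∧ FlatlyEmbedded (F.map f.hom) ∧
      Module.Finite Γ(T, V) (Apolar (F.map f.hom)) := by
  obtain ⟨r, hr, h⟩ := exists_isDualGenerator_map (I := I) (evaluation_surjective hU ht hc)
    hF hF₀ hFF₀
  let f := T.presheaf.map (homOfLE (T.basicOpen_le r)).op
  obtain ⟨n, b, hb⟩ := h f.hom (T.toRingedSpace.isUnit_res_basicOpen r)
  have : IsNoetherianRing Γ(T, T.basicOpen r) := by
    have := hU.isLocalization_basicOpen r
    exact IsLocalization.isNoetherianRing (Submonoid.powers r) _ inferInstance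
  refine ⟨T.basicOpen r, hU.basicOpen r, f, (T.evaluation_ne_zero_iff_mem_basicOpen t ht r).mp hr,
    hb.ann_eq, IsCutOutBy.eqApolarOver _ ?_, hb.flatlyEmbedded, hb.finite_apolar⟩
  rw [hb.ann_eq]
  exact hI.map f (hU.map_fromSpec (hU.basicOpen r) (homOfLE (T.basicOpen_le r)).op)

end Local

end ApolarFamily

/-! ### The local description theorem -/

theorem mainTheorem4 {k : Type u} [Field k] [IsAlgClosed k]
    {σ : Type u} [Finite σ]
    {T : Scheme.{u}} [IsLocallyNoetherian T] (s : T ⟶ Spec (CommRingCat.of k))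
    {X : Scheme.{u}} (i : X ⟶ 𝔸(σ; T)) [IsClosedImmersion i]
    (hfinite : IsFinite (i ≫ (𝔸(σ; T) ↘ T))) (hflat : Flat (i ≫ (𝔸(σ; T) ↘ T)))
    (hGor : ∀ t : T, ApolarFamily.GorensteinFibre i t)
    (t₀ : T) (ht₀ : IsClosed {t₀}) :
    ∃ (U : T.Opens) (hU : IsAffineOpen U) (F : ApolarFamily.DPSeries σ Γ(T, U)),
      t₀ ∈ U ∧
      ApolarFamily.EqApolarOver i hU F ∧
      ApolarFamily.FlatlyEmbedded F ∧
      Module.Finite Γ(T, U) (ApolarFamily.Apolar F) ∧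
      ((∀ t : T, ApolarFamily.FibreSupportedAtOrigin i t) → ApolarFamily.IsPolynomial F) ∧
      ((∀ t : T, ApolarFamily.FibreDilationInvariant i s t) → IsReduced T →
        ∃ d : ℕ, ApolarFamily.IsHomogeneous F d) := by
  obtain ⟨U, hU, ht, -⟩ := exists_isAffineOpen_mem_and_subset (U := ⊤) (x := t₀) trivial
  have : IsNoetherianRing Γ(T, U) := IsLocallyNoetherian.component_noetherian ⟨U, hU⟩
  obtain ⟨I, hI⟩ := ApolarFamily.exists_isCutOutBy (i := i) hU.fromSpec
  have := hI.finite hfinite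
  have := hI.flat hflat
  have hJ := hI.map (T.evaluation U t₀ ht) (ApolarFamily.evaluation_fromSpec hU ht)
  have hsurj := ApolarFamily.evaluation_surjective hU ht ht₀
  have := ApolarFamily.finite_quotient_map (I := I) (T.evaluation U t₀ ht).hom
  have hsoc := hJ.hasSimpleSocles (hGor t₀)
  -- The residue field contains the algebraically closed, hence infinite, field k.
  have : Infinite (T.residueField t₀) := by
    obtain ⟨f, -⟩ := Spec.map_surjective (T.fromSpecResidueField t₀ ≫ s)
    exact Infinite.of_injective f.hom f.hom.injective
  -- One F must serve both addenda, so the choice is made here; a homogeneous F is also a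
  -- polynomial, as there are finitely many variables.
  by_cases hd : (∀ t : T, ApolarFamily.FibreDilationInvariant i s t) ∧ IsReduced T
  · obtain ⟨hd, hred⟩ := hd
    have hIh := hI.containsComponents hU hd
    have hJh := ApolarFamily.containsComponents_of_dilationInvariant s hJ (hd t₀)
    obtain ⟨F₀, d, hF₀d, hF₀⟩ := ApolarFamily.exists_isHomogeneous_ann_eq hsoc hJh
    obtain ⟨F, hF, hFF₀⟩ := ApolarFamily.exists_lift_vanishes hsurj
      (ApolarFamily.vanishes_of_ann_eq hF₀)
    -- The homogeneous part of the lift still restricts to F₀, because F₀ is homogeneous of the same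
    -- degree d.
    obtain ⟨V, hV, f, htV, -, h₁, h₂, h₃⟩ := hI.exists_basicOpen hU ht ht₀
      (ApolarFamily.homogeneousPart_vanishes (d := d) hIh hF) hF₀ (fun p => by
        rw [ApolarFamily.homogeneousPart, LinearMap.comp_apply, hFF₀,
          ← ApolarFamily.homogeneousComponent_map, hF₀d.apply_homogeneousComponent])
    have h₄ := (ApolarFamily.isHomogeneous_homogeneousPart d F).map f.hom
    exact ⟨V, hV, _, htV, h₁, h₂, h₃, fun _ => h₄.isPolynomial, fun _ _ => ⟨d, h₄⟩⟩
  · obtain ⟨F₀, hF₀⟩ := ApolarFamily.exists_ann_eq hsoc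
    obtain ⟨F, hF, hFF₀⟩ := ApolarFamily.exists_lift_vanishes hsurj
      (ApolarFamily.vanishes_of_ann_eq hF₀)
    obtain ⟨V, hV, f, htV, hann, h₁, h₂, h₃⟩ := hI.exists_basicOpen hU ht ht₀ hF hF₀ hFF₀
    refine ⟨V, hV, _, htV, h₁, h₂, h₃, fun h => ?_, fun h h' => (hd ⟨h, h'⟩).elim⟩
    refine ApolarFamily.isPolynomial_of_vanishes (fun j => ?_)
      (ApolarFamily.map_vanishes f.hom hF)
    obtain ⟨N, hN⟩ := hI.exists_X_pow_mem hU h j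
    exact ⟨N, by simpa using Ideal.mem_map_of_mem (MvPolynomial.map f.hom) hN⟩
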